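/- For a permutation $\sigma$ of $[n]$ let $P_\sigma$ be its $n\times n$ permutation matrix ($P_\sigma(i,j)=1$ if $\sigma(i)=j$ and $0$ otherwise), let $y=\mathrm{vec}(P_\sigma)\in\mathbb{R}^{n^2}$, and let $P^{[2]}_\sigma=yy^{T}$, so that $P^{[2]}_\sigma(ij,kl)=P_\sigma(i,j)P_\sigma(k,l)$. The QAP polytope $\mathrm{QAP}_n\subset\mathbb{R}^{n^2\times n^2}$ is the convex hull of the set $V$ of all the matrices $P^{[2]}_\sigma$; a point of $\mathbb{R}^{n^2\times n^2}$ is written $Y=(Y_{ij,kl})$. Let $m,n\ge 7$, let $i_1,\dots,i_m\in[n]$ be distinct and let $j_1,\dots,j_m\in[n]$ be distinct. Then the inequality $$\sum_{r=1}^{m}Y_{i_rj_r,\,i_rj_r}-\sum_{1\le r<s\le m}Y_{i_rj_r,\,i_sj_s}\le 1$$ is facet-defining for $\mathrm{QAP}_n$: it holds for all $Y\in\mathrm{QAP}_n$, and the set of those $Y\in\mathrm{QAP}_n$ that satisfy it with equality is a non-empty face whose dimension is $\dim \mathrm{QAP}_n-1$. Moreover, let $S_k$ be the set of the $P^{[2]}_\sigma$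 such that $\sigma(i_r)=j_r$ for exactly $k$ of the indices $r\in[m]$. Then the elements of $V$ that satisfy the inequality with equality are exactly those of $S_1\cup S_2$, the set $S_0$ is non-empty, and for every $X\in S_0$ the set $S_1\cup S_2\cup\{X\}$ has the same linear span as $V$. -/

import Mathlib

/-- The linear inequality `f x ≤ b` defines a facet of `P`: it is valid for `P`, and the face
`{x ∈ P | f x = b}` is non-empty, of affine dimension one less than the affine dimension of `P`. -/
def DefinesFacet {E : Type*} [AddCommGroup E] [Module ℝ E] (P : Set E) (f : E →ₗ[ℝ] ℝ) (b : ℝ) :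
    Prop :=
  (∀ x ∈ P, f x ≤ b) ∧ {x ∈ P | f x = b}.Nonempty ∧
    Module.finrank ℝ (vectorSpan ℝ {x ∈ P | f x = b}) + 1 = Module.finrank ℝ (vectorSpan ℝ P)

namespace QAP

/-- The `n² × n²` real matrices; the entry `Y (i, j) (k, l)` is written `Y_{ij,kl}`. -/
abbrev Mat (n : ℕ) : Type := Matrix (Fin n × Fin n) (Fin n × Fin n) ℝ

/-- The vectorization of the permutation matrix of `σ`: its entry at `(i, j)` is `1` if
`σ i = j`, and `0` otherwise. -/
def permVec {n : ℕ} (σ : Equiv.Perm (Fin n)) : Fin n × Fin n → ℝ :=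
  fun p => σ.permMatrix ℝ p.1 p.2

/-- The matrix `y yᵀ`, where `y` is the vectorized permutation matrix of `σ`. -/
def vertex {n : ℕ} (σ : Equiv.Perm (Fin n)) : Mat n :=
  Matrix.vecMulVec (permVec σ) (permVec σ)

/-- The set of all matrices `y yᵀ`, over all permutations of `n` elements. -/
def vertices (n : ℕ) : Set (Mat n) :=
  Set.range fun σ : Equiv.Perm (Fin n) => vertex σ

/-- The QAP polytope. -/
def polytope (n : ℕ) : Set (Mat n) :=
  convexHull ℝ (vertices n)

/-- The class `S_k` of the vertices of those permutations `σ` for which `σ (i r) = j r` holds for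
exactly `k` of the indices `r`. -/
def vertexClass {n m : ℕ} (i j : Fin m → Fin n) (k : ℕ) : Set (Mat n) :=
  vertex '' {σ : Equiv.Perm (Fin n) | (Finset.univ.filter fun r => σ (i r) = j r).card = k}

/-- The left-hand side `∑_r Y_{i_r j_r, i_r j_r} - ∑_{r < s} Y_{i_r j_r, i_s j_s}`, as a linear
functional of `Y`. -/
def qap4Form {n m : ℕ} (i j : Fin m → Fin n) : Mat n →ₗ[ℝ] ℝ where
  toFun Y := ∑ r : Fin m, Y (i r, j r) (i r, j r)
    - ∑ r : Fin m, ∑ s ∈ Finset.Ioi r, Y (i r, j r) (i s, j s)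
  map_add' Y Z := by
    simp only [Matrix.add_apply, Finset.sum_add_distrib]
    ring
  map_smul' c Y := by
    simp only [Matrix.smul_apply, smul_eq_mul, ← Finset.mul_sum, RingHom.id_apply]
    ring

end QAP

/-! On a vertex of `S_k` the slack of the inequality is `(k - 1)(k - 2) / 2`, which gives validity
and the equality cases. For the span, let a linear `F` vanish on `S_1`, `S_2` and `X ∈ S_0`. Entries
of a vertex depend on two images of the permutation, so `σ ↦ F (vertex σ)` is "quadratic": its third
differences along pairwise disjoint permutations vanish (`CubeNull`). A fixed relabelling turns
matches into fixed points in a set `M` with at least seven elements. Subtract from `F` the multiple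
`c` of the slack that makes the difference `h` vanish at one permutation with three fixed points in
`M`; `h` still vanishes where there are one or two. Suitable cubes of permutations show that `h` is
constant on three fixed points, hence zero there, then zero for four or more, and finally for none
(`CubeNull.eq_zero`). As the slack at `X` is `1`, `c = 0`, so `F` vanishes on all vertices. The
facet property follows by linear algebra (`definesFacet_of_span`), since all vertices lie in an
affine hyperplane that avoids the origin. -/

namespace QAP

open Equiv

/-! ### Third-order differences along disjoint permutations -/

section Cube

variable {α : Type*}

/-- The third-order differences of `h` along pairwise disjoint permutations vanish. -/
def CubeNull (h : Perm α → ℝ) : Prop :=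
  ∀ σ p q r : Perm α, p.Disjoint q → p.Disjoint r → q.Disjoint r →
    h σ - h (σ * p) - h (σ * q) - h (σ * r) + h (σ * p * q) + h (σ * p * r) + h (σ * q * r)
      - h (σ * p * q * r) = 0

theorem CubeNull.sub {h g : Perm α → ℝ} (hh : CubeNull h) (hg : CubeNull g) :
    CubeNull fun σ => h σ - g σ := by
  intro σ p q r hpq hpr hqr
  linear_combination hh σ p q r hpq hpr hqr - hg σ p q r hpq hpr hqr

theorem CubeNull.const_mul {h : Perm α → ℝ} (hh : CubeNull h) (c : ℝ) :
    CubeNull fun σ => c * h σ := by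
  intro σ p q r hpq hpr hqr
  linear_combination c * hh σ p q r hpq hpr hqr

theorem cubeNull_const (c : ℝ) : CubeNull fun _ : Perm α => c := by
  intro σ p q r _ _ _
  ring

/-- A function of the images of two points has vanishing third-order differences. -/
theorem cubeNull_of_two_points (φ : α → α → ℝ) (a c : α) :
    CubeNull fun σ : Perm α => φ (σ a) (σ c) := by
  intro σ p q r hpq hpr hqr
  have hr : r a = a → r c = c → φ (σ a) (σ c) - φ ((σ * p) a) ((σ * p) c)
      - φ ((σ * q) a) ((σ * q) c) - φ ((σ * r) a) ((σ * r) c)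
      + φ ((σ * p * q) a) ((σ * p * q) c) + φ ((σ * p * r) a) ((σ * p * r) c)
      + φ ((σ * q * r) a) ((σ * q * r) c) - φ ((σ * p * q * r) a) ((σ * p * q * r) c) = 0 := by
    intro ha hc
    simp only [Perm.mul_apply, ha, hc]
    ring
  have hq : q a = a → q c = c → φ (σ a) (σ c) - φ ((σ * p) a) ((σ * p) c)
      - φ ((σ * q) a) ((σ * q) c) - φ ((σ * r) a) ((σ * r) c)
      + φ ((σ * p * q) a) ((σ * p * q) c) + φ ((σ * p * r) a) ((σ * p * r) c)
      + φ ((σ * q * r) a) ((σ * q * r) c) - φ ((σ * p * q * r) a) ((σ * p * q * r) c) = 0 := by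
    intro ha hc
    -- Disjoint permutations commute, so `q` can be made to act first, where it fixes both points.
    rw [mul_assoc σ q r, mul_assoc (σ * p) q r, hqr.commute.eq]
    simp only [Perm.mul_apply, ha, hc]
    ring
  have hp : p a = a → p c = c → φ (σ a) (σ c) - φ ((σ * p) a) ((σ * p) c)
      - φ ((σ * q) a) ((σ * q) c) - φ ((σ * r) a) ((σ * r) c)
      + φ ((σ * p * q) a) ((σ * p * q) c) + φ ((σ * p * r) a) ((σ * p * r) c)
      + φ ((σ * q * r) a) ((σ * q * r) c) - φ ((σ * p * q * r) a) ((σ * p * q * r) c) = 0 := by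
    intro ha hc
    rw [mul_assoc σ p q, mul_assoc σ p r, hpq.commute.eq, hpr.commute.eq, ← mul_assoc σ q p,
      mul_assoc (σ * q) p r, hpr.commute.eq]
    simp only [Perm.mul_apply, ha, hc]
    ring
  -- Each of `a` and `c` is moved by at most one of `p`, `q`, `r`, so one of the three fixes both;
  -- the terms then cancel in pairs.
  rcases hpq a with h1 | h1 <;> rcases hpr a with h2 | h2 <;> rcases hqr a with h3 | h3 <;>
    rcases hpq c with h4 | h4 <;> rcases hpr c with h5 | h5 <;> rcases hqr c with h6 | h6 <;>
    first
      | exact hr ‹_› ‹_›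
      | exact hq ‹_› ‹_›
      | exact hp ‹_› ‹_›

end Cube

/-! ### Fixed points in `M` and their change under transpositions -/

section FixedPoints

variable {α : Type*} [DecidableEq α]

theorem disjoint_swap_of_fixed {p : Perm α} {a b : α} (ha : p a = a) (hb : p b = b) :
    p.Disjoint (swap a b) := by
  intro x
  by_cases hxa : x = a
  · exact Or.inl (hxa ▸ ha)
  by_cases hxb : x = b
  · exact Or.inl (hxb ▸ hb)
  exact Or.inr (swap_apply_of_ne_of_ne hxa hxb)

theorem disjoint_swap_swap {a b c d : α} (hac : a ≠ c) (had : a ≠ d) (hbc : b ≠ c) (hbd : b ≠ d) :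
    (swap a b).Disjoint (swap c d) :=
  disjoint_swap_of_fixed (swap_apply_of_ne_of_ne hac.symm hbc.symm)
    (swap_apply_of_ne_of_ne had.symm hbd.symm)

/-- The permutation `a ↦ b ↦ c ↦ a`. -/
def rot (a b c : α) : Perm α := swap a c * swap a b

theorem rot_first {a b c : α} (hab : a ≠ b) (hbc : b ≠ c) : rot a b c a = b := by
  simp [rot, swap_apply_of_ne_of_ne hab.symm hbc]

theorem rot_second (a b c : α) : rot a b c b = c := by
  simp [rot]

theorem rot_third {a b c : α} (hac : a ≠ c) (hbc : b ≠ c) : rot a b c c = a := by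
  simp [rot, swap_apply_of_ne_of_ne hac.symm hbc.symm]

theorem rot_of_ne {a b c x : α} (ha : x ≠ a) (hb : x ≠ b) (hc : x ≠ c) : rot a b c x = x := by
  simp [rot, swap_apply_of_ne_of_ne ha hb, swap_apply_of_ne_of_ne ha hc]

/-- The fixed points of `σ` in `M`. -/
def fixedIn (M : Finset α) (σ : Perm α) : Finset α := M.filter fun a => σ a = a

variable {M : Finset α}

theorem mem_fixedIn {σ : Perm α} {a : α} : a ∈ fixedIn M σ ↔ a ∈ M ∧ σ a = a := by
  simp [fixedIn]

theorem mem_fixedIn_mul {σ p : Perm α} {a : α} (ha : p a = a) :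
    a ∈ fixedIn M (σ * p) ↔ a ∈ fixedIn M σ := by
  simp [mem_fixedIn, ha]

theorem fixedIn_mul_eq {σ p : Perm α} (h : ∀ x, p x ≠ x → x ∉ fixedIn M σ ∧ (x ∈ M → σ (p x) ≠ x)) :
    fixedIn M (σ * p) = fixedIn M σ := by
  ext x
  by_cases hx : p x = x
  · exact mem_fixedIn_mul hx
  · obtain ⟨h1, h2⟩ := h x hx
    simp only [mem_fixedIn, Perm.mul_apply, not_and] at h1 ⊢
    exact ⟨fun h => absurd h.2 (h2 h.1), fun h => absurd h.2 (h1 h.1)⟩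

theorem fixedIn_mul_swap {σ : Perm α} {a b : α} (ha : a ∈ fixedIn M σ) (hab : a ≠ b) :
    fixedIn M (σ * swap a b) = ((fixedIn M σ).erase a).erase b := by
  obtain ⟨_, haσ⟩ := mem_fixedIn.1 ha
  ext x
  rcases eq_or_ne x a with rfl | hxa
  · have : σ b ≠ x := fun h => hab (σ.injective (haσ.trans h.symm))
    simp [mem_fixedIn, this]
  rcases eq_or_ne x b with rfl | hxb
  · simp [mem_fixedIn, haσ, hab]
  · simp [mem_fixedIn, swap_apply_of_ne_of_ne hxa hxb, hxa, hxb]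

theorem fixedIn_mul_swap_of_notMem {σ : Perm α} {a b : α} (ha : a ∈ fixedIn M σ)
    (hb : b ∉ fixedIn M σ) : fixedIn M (σ * swap a b) = (fixedIn M σ).erase a := by
  rw [fixedIn_mul_swap ha (by rintro rfl; exact hb ha),
    Finset.erase_eq_of_notMem fun h => hb (Finset.mem_of_mem_erase h)]

variable {h : Perm α → ℝ}

/-- In the cube spanned by `p`, `swap a c`, `swap b d`, each transposition destroys one fixed point
and creates none. The six vertices other than `σ` and `σ * p` thus have one or two fixed points in
`M`, where `h` vanishes. -/
theorem CubeNull.eq_mul (hh : CubeNull h)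
    (h1 : ∀ σ, (fixedIn M σ).card = 1 → h σ = 0) (h2 : ∀ σ, (fixedIn M σ).card = 2 → h σ = 0)
    {σ p : Perm α} (hσ : (fixedIn M σ).card = 3) (hσp : (fixedIn M (σ * p)).card = 3)
    {a b c d : α} (ha : a ∈ fixedIn M σ) (hb : b ∈ fixedIn M σ) (hab : a ≠ b)
    (hc : c ∉ fixedIn M σ) (hd : d ∉ fixedIn M σ) (hcd : c ≠ d)
    (hpa : p a = a) (hpb : p b = b) (hpc : p c = c) (hpd : p d = d) : h σ = h (σ * p) := by
  have key : ∀ τ : Perm α, (fixedIn M τ).card = 3 → a ∈ fixedIn M τ → b ∈ fixedIn M τ →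
      c ∉ fixedIn M τ → d ∉ fixedIn M τ → h (τ * swap a c) = 0 ∧ h (τ * swap b d) = 0 ∧
        h (τ * swap a c * swap b d) = 0 := by
    intro τ hτ ha hb hc hd
    have e1 := fixedIn_mul_swap_of_notMem ha hc
    have e2 := fixedIn_mul_swap_of_notMem hb hd
    have hb' : b ∈ fixedIn M (τ * swap a c) := by
      rw [e1]; exact Finset.mem_erase.2 ⟨hab.symm, hb⟩
    have hd' : d ∉ fixedIn M (τ * swap a c) := by
      rw [e1]; exact fun h => hd (Finset.mem_of_mem_erase h)
    have e3 := fixedIn_mul_swap_of_notMem hb' hd'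
    have c1 : (fixedIn M (τ * swap a c)).card = 2 := by
      rw [e1, Finset.card_erase_of_mem ha, hτ]
    refine ⟨h2 _ c1, h2 _ ?_, h1 _ ?_⟩
    · rw [e2, Finset.card_erase_of_mem hb, hτ]
    · rw [e3, Finset.card_erase_of_mem hb', c1]
  obtain ⟨k1, k2, k3⟩ := key σ hσ ha hb hc hd
  obtain ⟨k4, k5, k6⟩ := key (σ * p) hσp ((mem_fixedIn_mul hpa).2 ha) ((mem_fixedIn_mul hpb).2 hb)
    (fun h => hc ((mem_fixedIn_mul hpc).1 h)) (fun h => hd ((mem_fixedIn_mul hpd).1 h))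
  have := hh σ p (swap a c) (swap b d) (disjoint_swap_of_fixed hpa hpc)
    (disjoint_swap_of_fixed hpb hpd) (disjoint_swap_swap hab (fun h => hd (h ▸ ha))
      (fun h => hc (h ▸ hb)) hcd)
  linarith

variable [Fintype α]

theorem exists_two_notMem (hα : 7 ≤ Fintype.card α) (s : Finset α) (hs : s.card ≤ 5) :
    ∃ c d, c ≠ d ∧ c ∉ s ∧ d ∉ s := by
  have : 1 < sᶜ.card := by rw [Finset.card_compl]; omega
  obtain ⟨c, hc, d, hd, hcd⟩ := Finset.one_lt_card.1 this
  exact ⟨c, d, hcd, Finset.mem_compl.1 hc, Finset.mem_compl.1 hd⟩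

/-- If a permutation `p` that moves at most two points outside the fixed points of `σ` in `M`
keeps two of the three fixed points of `σ` in `M`, then `h` does not change. -/
theorem CubeNull.eq_mul_of_support (hα : 7 ≤ Fintype.card α) (hh : CubeNull h)
    (h1 : ∀ σ, (fixedIn M σ).card = 1 → h σ = 0) (h2 : ∀ σ, (fixedIn M σ).card = 2 → h σ = 0)
    {σ p : Perm α} (hσ : (fixedIn M σ).card = 3) (hσp : (fixedIn M (σ * p)).card = 3)
    {a b x y : α} (ha : a ∈ fixedIn M σ) (hb : b ∈ fixedIn M σ) (hab : a ≠ b)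
    (hpa : p a = a) (hpb : p b = b)
    (hp : ∀ z, z ∉ fixedIn M σ → z ≠ x → z ≠ y → p z = z) : h σ = h (σ * p) := by
  -- Three fixed points with `x` and `y` make at most five points, so seven suffice to find `c` and
  -- `d`.
  obtain ⟨c, d, hcd, hc, hd⟩ := exists_two_notMem hα (insert x (insert y (fixedIn M σ)))
    (by
      have := Finset.card_insert_le x (insert y (fixedIn M σ))
      have := Finset.card_insert_le y (fixedIn M σ)
      omega)
  simp only [Finset.mem_insert, not_or] at hc hd
  exact hh.eq_mul h1 h2 hσ hσp ha hb hab hc.2.2 hd.2.2 hcd hpa hpb (hp c hc.2.2 hc.1 hc.2.1)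
    (hp d hd.2.2 hd.1 hd.2.1)

/-- The points at which two permutations differ. -/
def differ (σ τ : Perm α) : Finset α := Finset.univ.filter fun x => σ x ≠ τ x

theorem mem_differ {σ τ : Perm α} {x : α} : x ∈ differ σ τ ↔ σ x ≠ τ x := by
  simp [differ]

/-- Since `p` moves only points of disagreement, no agreement is lost, and one is gained at `x`. -/
theorem differ_mul_card_lt {σ τ p : Perm α} {x : α} (hx : σ x ≠ τ x) (hpx : σ (p x) = τ x)
    (hp : ∀ z, p z ≠ z → σ z ≠ τ z) : (differ (σ * p) τ).card < (differ σ τ).card := by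
  apply Finset.card_lt_card
  rw [Finset.ssubset_iff_of_subset]
  · exact ⟨x, mem_differ.2 hx, fun h => mem_differ.1 h hpx⟩
  · intro z hz
    rw [mem_differ] at hz ⊢
    by_cases hpz : p z = z
    · simpa [hpz] using hz
    · exact hp z hpz

end FixedPoints

/-! ### Vanishing of `h` for every number of fixed points -/

section FixedPoints

variable {α : Type*} [DecidableEq α] {M : Finset α} {h : Perm α → ℝ}

theorem eq_of_mem_moved_swap {x y z : α} (hz : swap x y z ≠ z) : z = x ∨ z = y := by
  by_contra hc
  rw [not_or] at hc
  exact hz (swap_apply_of_ne_of_ne hc.1 hc.2)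

theorem eq_of_mem_moved_rot {a b c z : α} (hz : rot a b c z ≠ z) : z = a ∨ z = b ∨ z = c := by
  by_contra hc
  rw [not_or, not_or] at hc
  exact hz (rot_of_ne hc.1 hc.2.1 hc.2.2)

/-- For `b ∈ M`, the transposition of `σ⁻¹ b` and `b` makes `b` fixed. Three such disjoint
transpositions span a cube in which every vertex but `σ` has a fixed point in `M`. Each chosen `b`
excludes at most `b`, `σ⁻¹ b`, `σ b` from later choices, so seven elements of `M` suffice. -/
theorem CubeNull.eq_zero_of_card_eq_zero (hM : 7 ≤ M.card) (hh : CubeNull h)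
    (hpos : ∀ σ, 1 ≤ (fixedIn M σ).card → h σ = 0) (σ : Perm α) (hσ : (fixedIn M σ).card = 0) :
    h σ = 0 := by
  have hne : ∀ b ∈ M, σ.symm b ≠ b := by
    intro b hb hfix
    have : b ∈ fixedIn M σ := mem_fixedIn.2 ⟨hb, (σ.symm_apply_eq.1 hfix).symm⟩
    rw [Finset.card_eq_zero.1 hσ] at this
    simp at this
  obtain ⟨b₁, hb1⟩ : M.Nonempty := Finset.card_pos.1 (by omega)
  obtain ⟨b₂, hb2, hn2⟩ := Finset.exists_mem_notMem_of_card_lt_card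
    (s := {b₁, σ.symm b₁, σ b₁}) (t := M) (lt_of_le_of_lt Finset.card_le_three (by omega))
  obtain ⟨b₃, hb3, hn3⟩ := Finset.exists_mem_notMem_of_card_lt_card
    (s := {b₁, σ.symm b₁, σ b₁, b₂, σ.symm b₂, σ b₂}) (t := M)
    (lt_of_le_of_lt Finset.card_le_six (by omega))
  simp only [Finset.mem_insert, Finset.mem_singleton, not_or] at hn2 hn3
  obtain ⟨n1, n2, n3⟩ := hn2
  obtain ⟨k1, k2, k3, k4, k5, k6⟩ := hn3
  have hdis : ∀ b c : α, c ≠ b → c ≠ σ.symm b → c ≠ σ b →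
      (swap (σ.symm b) b).Disjoint (swap (σ.symm c) c) := by
    intro b c h1 h2 h3
    refine disjoint_swap_swap (fun h => h1 (σ.symm.injective h).symm) h2.symm ?_ h1.symm
    rintro rfl
    exact h3 (by simp)
  have hzero : ∀ (b : α) (p : Perm α), b ∈ M → p b = σ.symm b → h (σ * p) = 0 := by
    intro b p hb hp
    exact hpos _ (Finset.card_pos.2 ⟨b, mem_fixedIn.2 ⟨hb, by simp [hp]⟩⟩)
  have d12 := hdis b₁ b₂ n1 n2 n3
  have d13 := hdis b₁ b₃ k1 k2 k3
  have d23 := hdis b₂ b₃ k4 k5 k6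
  have hfix : ∀ b c : α, b ∈ M → (swap (σ.symm b) b).Disjoint (swap (σ.symm c) c) →
      swap (σ.symm c) c b = b := by
    intro b c hb hd
    refine (hd b).resolve_left ?_
    rw [swap_apply_right]
    exact hne b hb
  have := hh σ _ _ _ d12 d13 d23
  have f12 := hfix b₁ b₂ hb1 d12
  have f13 := hfix b₁ b₃ hb1 d13
  have f23 := hfix b₂ b₃ hb2 d23
  have z1 := hzero b₁ (swap (σ.symm b₁) b₁) hb1 (by simp)
  have z2 := hzero b₂ (swap (σ.symm b₂) b₂) hb2 (by simp)
  have z3 := hzero b₃ (swap (σ.symm b₃) b₃) hb3 (by simp)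
  have z12 := hzero b₁ (swap (σ.symm b₁) b₁ * swap (σ.symm b₂) b₂) hb1 (by simp [f12])
  have z13 := hzero b₁ (swap (σ.symm b₁) b₁ * swap (σ.symm b₃) b₃) hb1 (by simp [f13])
  have z23 := hzero b₂ (swap (σ.symm b₂) b₂ * swap (σ.symm b₃) b₃) hb2 (by simp [f23])
  have z123 := hzero b₁ (swap (σ.symm b₁) b₁ * swap (σ.symm b₂) b₂ * swap (σ.symm b₃) b₃) hb1
    (by simp [f12, f13])
  simp only [← mul_assoc] at z12 z13 z23 z123
  linarith

variable [Fintype α]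

/-- Multiplication by a transposition that keeps the fixed points in `M` does not change `h`. -/
theorem CubeNull.eq_mul_swap (hα : 7 ≤ Fintype.card α) (hh : CubeNull h)
    (h1 : ∀ σ, (fixedIn M σ).card = 1 → h σ = 0) (h2 : ∀ σ, (fixedIn M σ).card = 2 → h σ = 0)
    {σ : Perm α} (hσ : (fixedIn M σ).card = 3) {x y : α} (hx : x ∉ fixedIn M σ)
    (hy : y ∉ fixedIn M σ) (hxy : y ∈ M → σ x ≠ y) (hyx : x ∈ M → σ y ≠ x) :
    fixedIn M (σ * swap x y) = fixedIn M σ ∧ h σ = h (σ * swap x y) := by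
  have hfix : fixedIn M (σ * swap x y) = fixedIn M σ := by
    refine fixedIn_mul_eq fun z hz => ?_
    rcases eq_of_mem_moved_swap hz with rfl | rfl
    · simpa using ⟨hx, hyx⟩
    · simpa using ⟨hy, hxy⟩
  refine ⟨hfix, ?_⟩
  have hfixed : ∀ a ∈ fixedIn M σ, swap x y a = a := fun a ha =>
    swap_apply_of_ne_of_ne (fun e => hx (e ▸ ha)) (fun e => hy (e ▸ ha))
  obtain ⟨a, ha, b, hb, hab⟩ := Finset.one_lt_card.1 (by omega : 1 < (fixedIn M σ).card)
  exact hh.eq_mul_of_support hα h1 h2 hσ (hfix ▸ hσ) ha hb hab (hfixed a ha) (hfixed b hb)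
    fun z _ hzx hzy => swap_apply_of_ne_of_ne hzx hzy

/-- A fixed point of `σ` can be exchanged for a fixed point of `τ`. -/
theorem CubeNull.exists_closer_of_fixedIn_ne (hα : 7 ≤ Fintype.card α) (hh : CubeNull h)
    (h1 : ∀ σ, (fixedIn M σ).card = 1 → h σ = 0) (h2 : ∀ σ, (fixedIn M σ).card = 2 → h σ = 0)
    {σ τ : Perm α} (hσ : (fixedIn M σ).card = 3) (hτ : (fixedIn M τ).card = 3)
    (hne : fixedIn M σ ≠ fixedIn M τ) :
    ∃ σ', (fixedIn M σ').card = 3 ∧ h σ = h σ' ∧ (differ σ' τ).card < (differ σ τ).card := by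
  obtain ⟨a, haτ, haσ⟩ : ∃ a ∈ fixedIn M τ, a ∉ fixedIn M σ := by
    by_contra! hc
    exact hne (Finset.eq_of_subset_of_card_le hc (by omega)).symm
  obtain ⟨e, heσ, heτ⟩ : ∃ e ∈ fixedIn M σ, e ∉ fixedIn M τ := by
    by_contra! hc
    exact hne (Finset.eq_of_subset_of_card_le hc (by omega))
  obtain ⟨haM, ha⟩ := mem_fixedIn.1 haτ
  obtain ⟨heM, he⟩ := mem_fixedIn.1 heσ
  have hσa : σ a ≠ a := fun h => haσ (mem_fixedIn.2 ⟨haM, h⟩)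
  have hτe : τ e ≠ e := fun h => heτ (mem_fixedIn.2 ⟨heM, h⟩)
  obtain ⟨y, hy⟩ := σ.surjective a
  have hay : a ≠ y := by rintro rfl; exact hσa hy
  have hae : a ≠ e := by rintro rfl; exact hτe ha
  have hye : y ≠ e := by rintro rfl; exact hae (hy.symm.trans he)
  have hyσ : y ∉ fixedIn M σ := fun h => hay (hy.symm.trans (mem_fixedIn.1 h).2)
  -- The product sends `a` to `a`, `y` to `e` and `e` to `σ a`: it gains the fixed point `a`, loses
  -- `e` and keeps the other two.
  have hfix : fixedIn M (σ * rot a y e) = insert a ((fixedIn M σ).erase e) := by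
    ext z
    rcases eq_or_ne z a with rfl | hza
    · simp [mem_fixedIn, rot_first hay hye, hy, haM]
    rcases eq_or_ne z e with rfl | hze
    · have : σ a ≠ z := fun h => hae (σ.injective (h.trans he.symm))
      simp [mem_fixedIn, rot_third hae hye, hza, this]
    rcases eq_or_ne z y with rfl | hzy
    · simp [mem_fixedIn, rot_second, he, hye.symm, hza, hy, hay]
    · rw [mem_fixedIn_mul (rot_of_ne hza hzy hze)]
      simp [hza, hze]
  have hcard : (fixedIn M (σ * rot a y e)).card = 3 := by
    rw [hfix, Finset.card_insert_of_notMem (fun h => haσ (Finset.mem_of_mem_erase h)),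
      Finset.card_erase_of_mem heσ, hσ]
  obtain ⟨b, hb, c, hc, hbc⟩ := Finset.one_lt_card.1
    (by rw [Finset.card_erase_of_mem heσ]; omega : 1 < ((fixedIn M σ).erase e).card)
  rw [Finset.mem_erase] at hb hc
  have hfixed : ∀ b, b ≠ e ∧ b ∈ fixedIn M σ → rot a y e b = b := fun b hb =>
    rot_of_ne (fun h => haσ (h ▸ hb.2)) (fun h => hyσ (h ▸ hb.2)) hb.1
  refine ⟨_, hcard, hh.eq_mul_of_support hα h1 h2 hσ hcard hb.2 hc.2 hbc (hfixed b hb) (hfixed c hc)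
    (x := a) (y := y) fun z hz hza hzy => rot_of_ne hza hzy fun h => hz (h ▸ heσ), ?_⟩
  refine differ_mul_card_lt (x := a) (by rwa [ha]) (by rw [rot_first hay hye, hy, ha]) ?_
  intro z hz
  rcases eq_of_mem_moved_rot hz with rfl | rfl | rfl
  · rwa [ha]
  · rw [hy, ← ha]
    exact fun h => hay (τ.injective h)
  · rw [he]
    exact hτe.symm

/-- To correct `σ` at `x`, swap `x` with `y = σ⁻¹ (τ x)`; this fails only if it makes `y` a new
fixed point in `M`, that is, if `y ∈ M` and `σ x = y`. If it fails at every point of disagreement,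
then `τ = σ²` at all of these, and a 3-cycle along an orbit `x, y, z` of `σ` is used instead. -/
theorem CubeNull.exists_closer_of_fixedIn_eq (hM : 7 ≤ M.card) (hh : CubeNull h)
    (h1 : ∀ σ, (fixedIn M σ).card = 1 → h σ = 0) (h2 : ∀ σ, (fixedIn M σ).card = 2 → h σ = 0)
    {σ τ : Perm α} (hσ : (fixedIn M σ).card = 3) (heq : fixedIn M σ = fixedIn M τ) (hne : σ ≠ τ) :
    ∃ σ', (fixedIn M σ').card = 3 ∧ h σ = h σ' ∧ (differ σ' τ).card < (differ σ τ).card := by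
  have hα : 7 ≤ Fintype.card α := hM.trans (Finset.card_le_univ M)
  have hD : ∀ x, σ x ≠ τ x → x ∉ fixedIn M σ := fun x hx hxσ =>
    hx ((mem_fixedIn.1 hxσ).2.trans (mem_fixedIn.1 (heq ▸ hxσ)).2.symm)
  have hDτ : ∀ x, σ x ≠ τ x → x ∈ M → τ x ≠ x := fun x hx hxM h =>
    hD x hx (heq ▸ mem_fixedIn.2 ⟨hxM, h⟩)
  by_cases hgood : ∃ x y, σ x ≠ τ x ∧ σ y = τ x ∧ (y ∈ M → σ x ≠ y)
  · obtain ⟨x, y, hx, hy, hxy⟩ := hgood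
    have hyD : σ y ≠ τ y := by
      rw [hy]
      exact fun h => hx (τ.injective h ▸ hy)
    obtain ⟨hfix, hval⟩ := hh.eq_mul_swap hα h1 h2 hσ (hD x hx) (hD y hyD) hxy
      (fun hxM => hy ▸ hDτ x hx hxM)
    refine ⟨_, hfix ▸ hσ, hval, differ_mul_card_lt hx (by rwa [swap_apply_left]) ?_⟩
    intro z hz
    rcases eq_of_mem_moved_swap hz with rfl | rfl <;> assumption
  · push Not at hgood
    have hstep : ∀ x, σ x ≠ τ x → σ x ∈ M ∧ σ (σ x) = τ x ∧ σ (σ x) ≠ τ (σ x) ∧ σ x ≠ x := by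
      intro x hx
      obtain ⟨y, hy⟩ := σ.surjective (τ x)
      obtain ⟨hyM, hxy⟩ := hgood x y hx hy
      rw [hxy]
      refine ⟨hyM, hy, ?_, ?_⟩
      · rw [hy]
        exact fun h => hx (τ.injective h ▸ hy)
      · rintro rfl
        exact hx hy
    obtain ⟨x, hx⟩ : ∃ x, σ x ≠ τ x := by
      by_contra! hc
      exact hne (Equiv.ext hc)
    obtain ⟨y, hy⟩ : ∃ y, y = σ x := ⟨_, rfl⟩
    obtain ⟨z, hz⟩ : ∃ z, z = σ y := ⟨_, rfl⟩
    obtain ⟨w, hw⟩ : ∃ w, w = σ z := ⟨_, rfl⟩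
    obtain ⟨hyM, hxz, hyD, hyx⟩ := hstep x hx
    rw [← hy] at hyM hxz hyD hyx
    obtain ⟨hzM, hyw, hzD, hzy⟩ := hstep y hyD
    rw [← hz] at hzM hyw hzD hzy hxz
    obtain ⟨hwM, -, -, hwz⟩ := hstep z hzD
    rw [← hw] at hwM hyw hwz
    have hwy : w ≠ y := hyw ▸ hDτ y hyD hyM
    have hzx : z ≠ x := by
      rintro rfl
      exact hwy (hw.trans hy.symm)
    suffices hsuff : (fixedIn M (σ * rot x y z)).card = 3 ∧ h σ = h (σ * rot x y z) by
      refine ⟨_, hsuff.1, hsuff.2, differ_mul_card_lt hx ?_ ?_⟩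
      · rw [rot_first hyx.symm hzy.symm, ← hz, hxz]
      · intro u hu
        rcases eq_of_mem_moved_rot hu with rfl | rfl | rfl <;> assumption
    -- If `σ` cycles `x, y, z`, swapping two of them would create a fixed point in `M`, so the
    -- 3-cycle is applied at once; otherwise it splits into two admissible transpositions.
    by_cases hwx : w = x
    · subst hwx
      have hfix : fixedIn M (σ * rot w y z) = fixedIn M σ := by
        refine fixedIn_mul_eq fun u hu => ?_
        rcases eq_of_mem_moved_rot hu with rfl | rfl | rfl
        · rw [rot_first hyx.symm hzy.symm, ← hz]
          exact ⟨hD _ hx, fun _ => hzx⟩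
        · rw [rot_second, ← hw]
          exact ⟨hD _ hyD, fun _ => hwy⟩
        · rw [rot_third hzx.symm hzy.symm, ← hy]
          exact ⟨hD _ hzD, fun _ => hzy.symm⟩
      refine ⟨hfix ▸ hσ, ?_⟩
      have hfixed : ∀ a ∈ fixedIn M σ, rot w y z a = a := fun a ha =>
        rot_of_ne (fun e => hD w hx (e ▸ ha)) (fun e => hD y hyD (e ▸ ha))
          (fun e => hD z hzD (e ▸ ha))
      obtain ⟨a, ha, b, hb, hab⟩ := Finset.one_lt_card.1 (by omega : 1 < (fixedIn M σ).card)
      -- At most six points are excluded, which leaves some `c ∈ M`. The second point is `σ c`, as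
      -- the excluded set is invariant under `σ`.
      obtain ⟨c, hcM, hc⟩ := Finset.exists_mem_notMem_of_card_lt_card
        (s := insert w (insert y (insert z (fixedIn M σ)))) (t := M) (by
          have := Finset.card_insert_le w (insert y (insert z (fixedIn M σ)))
          have := Finset.card_insert_le y (insert z (fixedIn M σ))
          have := Finset.card_insert_le z (fixedIn M σ)
          omega)
      simp only [Finset.mem_insert, not_or] at hc
      obtain ⟨hcw, hcy, hcz, hcσ⟩ := hc
      have hσc : σ c ≠ c := fun h => hcσ (mem_fixedIn.2 ⟨hcM, h⟩)
      refine hh.eq_mul h1 h2 hσ (hfix ▸ hσ) ha hb hab hcσ (d := σ c) ?_ hσc.symm (hfixed a ha)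
        (hfixed b hb) (rot_of_ne hcw hcy hcz) (rot_of_ne ?_ ?_ ?_)
      · exact fun h => hσc (σ.injective (mem_fixedIn.1 h).2)
      · exact fun h => hcz (σ.injective (h.trans hw))
      · exact fun h => hcw (σ.injective (h.trans hy))
      · exact fun h => hcy (σ.injective (h.trans hz))
    · obtain ⟨hfix, hval⟩ := hh.eq_mul_swap hα h1 h2 hσ (hD x hx) (hD z hzD)
        (fun _ => hy ▸ hzy.symm) (fun _ => hw ▸ hwx)
      have hx' : (σ * swap x z) x = w := by simp [hw]
      have hy' : (σ * swap x z) y = z := by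
        rw [Perm.mul_apply, swap_apply_of_ne_of_ne hyx hzy.symm, hz]
      obtain ⟨hfix', hval'⟩ := hh.eq_mul_swap hα h1 h2 (hfix ▸ hσ) (x := x) (y := y)
        (hfix ▸ hD x hx) (hfix ▸ hD y hyD) (fun _ => by rwa [hx']) (fun _ => by rwa [hy'])
      rw [mul_assoc] at hfix' hval'
      exact ⟨by rw [rot, hfix', hfix, hσ], hval.trans hval'⟩

/-- `h` is constant on the permutations with three fixed points in `M`. -/
theorem CubeNull.eq_of_card_fixedIn_eq_three (hM : 7 ≤ M.card) (hh : CubeNull h)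
    (h1 : ∀ σ, (fixedIn M σ).card = 1 → h σ = 0) (h2 : ∀ σ, (fixedIn M σ).card = 2 → h σ = 0)
    {σ τ : Perm α} (hσ : (fixedIn M σ).card = 3) (hτ : (fixedIn M τ).card = 3) : h σ = h τ := by
  induction hk : (differ σ τ).card using Nat.strong_induction_on generalizing σ with
  | _ k ih =>
    by_cases hne : σ = τ
    · rw [hne]
    obtain ⟨σ', hσ', hval, hlt⟩ : ∃ σ', (fixedIn M σ').card = 3 ∧ h σ = h σ' ∧
        (differ σ' τ).card < (differ σ τ).card := by
      by_cases heq : fixedIn M σ = fixedIn M τ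
      · exact hh.exists_closer_of_fixedIn_eq hM h1 h2 hσ heq hne
      · exact hh.exists_closer_of_fixedIn_ne (hM.trans (Finset.card_le_univ M)) h1 h2 hσ hτ heq
    rw [hval]
    exact ih _ (hk ▸ hlt) hσ' rfl

/-- With four or more fixed points in `M`, keep one, `a₀`, and swap three others with points `b₁,
b₂, b₃` outside the chosen four. The other seven vertices of this cube have fewer fixed points in
`M` but still `a₀`, so strong induction applies. -/
theorem CubeNull.eq_zero_of_one_le_card (hM : 7 ≤ M.card) (hh : CubeNull h)
    (h1 : ∀ σ, (fixedIn M σ).card = 1 → h σ = 0) (h2 : ∀ σ, (fixedIn M σ).card = 2 → h σ = 0)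
    (h3 : ∀ σ, (fixedIn M σ).card = 3 → h σ = 0) (σ : Perm α) (hσ : 1 ≤ (fixedIn M σ).card) :
    h σ = 0 := by
  induction hk : (fixedIn M σ).card using Nat.strong_induction_on generalizing σ with
  | _ k ih =>
    rcases (by omega : k = 1 ∨ k = 2 ∨ k = 3 ∨ 4 ≤ k) with rfl | rfl | rfl | h4
    · exact h1 σ hk
    · exact h2 σ hk
    · exact h3 σ hk
    obtain ⟨s, hs, hs4⟩ := Finset.exists_subset_card_eq (hk ▸ h4)
    obtain ⟨t, hst, ht7⟩ := Finset.exists_subset_card_eq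
      (s := sᶜ) (n := 3) (by
        have := Finset.card_le_univ M
        rw [Finset.card_compl]; omega)
    obtain ⟨b₁, b₂, b₃, hb12, hb13, hb23, rfl⟩ := Finset.card_eq_three.1 ht7
    obtain ⟨a₀, ha₀⟩ : s.Nonempty := Finset.card_pos.1 (by omega)
    obtain ⟨a₁, a₂, a₃, ha12, ha13, ha23, hsa⟩ := Finset.card_eq_three.1
      (by rw [Finset.card_erase_of_mem ha₀, hs4] : (s.erase a₀).card = 3)
    have hb : ∀ b ∈ ({b₁, b₂, b₃} : Finset α), ∀ a ∈ s, a ≠ b := by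
      rintro b hb a ha rfl
      exact Finset.mem_compl.1 (hst hb) ha
    have ha : ∀ a ∈ ({a₁, a₂, a₃} : Finset α), a ≠ a₀ ∧ a ∈ s := by
      intro a ha
      rwa [← hsa, Finset.mem_erase] at ha
    simp only [Finset.mem_insert, Finset.mem_singleton, forall_eq_or_imp, forall_eq] at ha hb
    obtain ⟨⟨n1, m1⟩, ⟨n2, m2⟩, ⟨n3, m3⟩⟩ := ha
    obtain ⟨q1, q2, q3⟩ := hb
    have hstep : ∀ (τ : Perm α) (a b : α), a₀ ∈ fixedIn M τ → a ∈ fixedIn M τ → a ≠ a₀ → a₀ ≠ b →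
        a ≠ b → a₀ ∈ fixedIn M (τ * swap a b) ∧ fixedIn M (τ * swap a b) ⊂ fixedIn M τ := by
      intro τ a b h0 ha hne h0b hab
      rw [fixedIn_mul_swap ha hab]
      refine ⟨by simp [h0, hne.symm, h0b], ?_⟩
      exact (Finset.erase_subset _ _).trans_ssubset (Finset.erase_ssubset ha)
    have hmem : ∀ (τ : Perm α) (a b c : α), c ∈ fixedIn M τ → c ≠ a → c ≠ b →
        c ∈ fixedIn M (τ * swap a b) := fun τ a b c hc hca hcb =>
      (mem_fixedIn_mul (swap_apply_of_ne_of_ne hca hcb)).2 hc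
    have hzero : ∀ τ : Perm α, a₀ ∈ fixedIn M τ → fixedIn M τ ⊂ fixedIn M σ → h τ = 0 :=
      fun τ h0 hτ => ih _ (hk ▸ Finset.card_lt_card hτ) τ (Finset.card_pos.2 ⟨a₀, h0⟩) rfl
    have s0 := hs ha₀
    obtain ⟨e1, f1⟩ := hstep σ a₁ b₁ s0 (hs m1) n1 (q1 _ ha₀) (q1 _ m1)
    obtain ⟨e2, f2⟩ := hstep σ a₂ b₂ s0 (hs m2) n2 (q2 _ ha₀) (q2 _ m2)
    obtain ⟨e3, f3⟩ := hstep σ a₃ b₃ s0 (hs m3) n3 (q3 _ ha₀) (q3 _ m3)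
    have g2 := hmem σ a₁ b₁ a₂ (hs m2) ha12.symm (q1 _ m2)
    have g3 := hmem σ a₁ b₁ a₃ (hs m3) ha13.symm (q1 _ m3)
    have g3' := hmem σ a₂ b₂ a₃ (hs m3) ha23.symm (q2 _ m3)
    have g3'' := hmem _ a₂ b₂ a₃ g3 ha23.symm (q2 _ m3)
    obtain ⟨e12, f12⟩ := hstep _ a₂ b₂ e1 g2 n2 (q2 _ ha₀) (q2 _ m2)
    obtain ⟨e13, f13⟩ := hstep _ a₃ b₃ e1 g3 n3 (q3 _ ha₀) (q3 _ m3)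
    obtain ⟨e23, f23⟩ := hstep _ a₃ b₃ e2 g3' n3 (q3 _ ha₀) (q3 _ m3)
    obtain ⟨e123, f123⟩ := hstep _ a₃ b₃ e12 g3'' n3 (q3 _ ha₀) (q3 _ m3)
    have := hh σ (swap a₁ b₁) (swap a₂ b₂) (swap a₃ b₃)
      (disjoint_swap_swap ha12 (q2 _ m1) (q1 _ m2).symm hb12)
      (disjoint_swap_swap ha13 (q3 _ m1) (q1 _ m3).symm hb13)
      (disjoint_swap_swap ha23 (q3 _ m2) (q2 _ m3).symm hb23)
    linarith [hzero _ e1 f1, hzero _ e2 f2, hzero _ e3 f3, hzero _ e12 (f12.trans f1),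
      hzero _ e13 (f13.trans f1), hzero _ e23 (f23.trans f2),
      hzero _ e123 (f123.trans (f12.trans f1))]

/-- A function with vanishing third-order differences that vanishes on the permutations with one
or two fixed points in `M`, and on one with three of them, is zero. -/
theorem CubeNull.eq_zero (hM : 7 ≤ M.card) (hh : CubeNull h)
    (h1 : ∀ σ, (fixedIn M σ).card = 1 → h σ = 0) (h2 : ∀ σ, (fixedIn M σ).card = 2 → h σ = 0)
    {ρ : Perm α} (hρ : (fixedIn M ρ).card = 3) (hρ0 : h ρ = 0) (σ : Perm α) : h σ = 0 := by
  have hpos := hh.eq_zero_of_one_le_card hM h1 h2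
    fun σ hσ => (hh.eq_of_card_fixedIn_eq_three hM h1 h2 hσ hρ).trans hρ0
  rcases Nat.eq_zero_or_pos (fixedIn M σ).card with h0 | h0
  · exact hh.eq_zero_of_card_eq_zero hM hpos σ h0
  · exact hpos σ h0

/-- There are permutations with any number of fixed points in `M`, up to two less than the number
of all points. -/
theorem exists_card_fixedIn_eq {k : ℕ} (hk : k ≤ M.card) (hk2 : k + 2 ≤ Fintype.card α) :
    ∃ σ : Perm α, (fixedIn M σ).card = k := by
  obtain ⟨s, hs, rfl⟩ := Finset.exists_subset_card_eq hk
  -- A cycle through all points outside `s` moves each of them only if there are at least two.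
  have hlen : 2 ≤ sᶜ.toList.length := by
    rw [Finset.length_toList, Finset.card_compl]; omega
  have hsupp := List.support_formPerm_of_nodup sᶜ.toList (Finset.nodup_toList _) (by
    intro x hx
    rw [hx] at hlen
    simp at hlen)
  refine ⟨sᶜ.toList.formPerm, congrArg Finset.card ?_⟩
  ext x
  have hx : x ∈ sᶜ.toList.formPerm.support ↔ x ∉ s := by
    rw [hsupp]
    simp
  rw [Perm.mem_support, not_iff_not] at hx
  rw [mem_fixedIn, hx]
  exact ⟨fun h => h.2, fun h => ⟨hs h, h⟩⟩

end FixedPoints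

/-! ### Vertices, slack and linear span -/

section Vertices

variable {n m : ℕ}

theorem permVec_apply (σ : Perm (Fin n)) (a b : Fin n) :
    permVec σ (a, b) = if σ a = b then 1 else 0 := by
  simp [permVec, Perm.permMatrix, PEquiv.toMatrix_apply, Equiv.toPEquiv_apply, eq_comm]

theorem vertex_apply (σ : Perm (Fin n)) (p q : Fin n × Fin n) :
    vertex σ p q = (if σ p.1 = p.2 then 1 else 0) * (if σ q.1 = q.2 then 1 else 0) := by
  rw [vertex, Matrix.vecMulVec_apply, ← permVec_apply, ← permVec_apply]

theorem cubeNull_comp_vertex (F : Mat n →ₗ[ℝ] ℝ) (e : Perm (Fin n)) :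
    CubeNull fun σ => F (vertex (e * σ)) := by
  intro σ p q r hpq hpr hqr
  have key : vertex (e * σ) - vertex (e * (σ * p)) - vertex (e * (σ * q)) - vertex (e * (σ * r))
      + vertex (e * (σ * p * q)) + vertex (e * (σ * p * r)) + vertex (e * (σ * q * r))
      - vertex (e * (σ * p * q * r)) = 0 := by
    ext u v
    simp only [Matrix.sub_apply, Matrix.add_apply, vertex_apply, Matrix.zero_apply,
      Perm.mul_apply e]
    exact cubeNull_of_two_points (fun a c => (if e a = u.2 then 1 else 0) *
      (if e c = v.2 then 1 else 0)) u.1 v.1 σ p q r hpq hpr hqr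
  simpa only [map_add, map_sub, map_zero] using congrArg F key

/-- The number of the indices `r` with `σ (i r) = j r`. -/
def matchCount (i j : Fin m → Fin n) (σ : Perm (Fin n)) : ℕ :=
  (Finset.univ.filter fun r => σ (i r) = j r).card

theorem mem_vertexClass {i j : Fin m → Fin n} {k : ℕ} {Y : Mat n} :
    Y ∈ vertexClass i j k ↔ ∃ σ, matchCount i j σ = k ∧ vertex σ = Y := Iff.rfl

theorem vertex_mem_vertexClass {i j : Fin m → Fin n} {k : ℕ} {σ : Perm (Fin n)}
    (h : matchCount i j σ = k) : vertex σ ∈ vertexClass i j k := ⟨σ, h, rfl⟩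

theorem vertexClass_subset (i j : Fin m → Fin n) (k : ℕ) : vertexClass i j k ⊆ vertices n := by
  rintro _ ⟨σ, -, rfl⟩
  exact ⟨σ, rfl⟩

theorem qap4Form_apply (i j : Fin m → Fin n) (Y : Mat n) :
    qap4Form i j Y = ∑ r : Fin m, Y (i r, j r) (i r, j r)
      - ∑ r : Fin m, ∑ s ∈ Finset.Ioi r, Y (i r, j r) (i s, j s) := rfl

theorem two_mul_sum_Ioi_mul (x : Fin m → ℝ) :
    2 * ∑ r, ∑ s ∈ Finset.Ioi r, x r * x s = (∑ r, x r) ^ 2 - ∑ r, x r * x r := by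
  have h1 : ∑ r, ∑ s ∈ Finset.Ioi r, x r * x s = ∑ r, ∑ s, if r < s then x r * x s else 0 := by
    refine Finset.sum_congr rfl fun r _ => ?_
    rw [← Finset.sum_filter]
    congr 1
    ext s
    simp
  have h2 : ∑ r, ∑ s, (if r < s then x r * x s else 0)
      = ∑ r, ∑ s, if s < r then x r * x s else 0 := by
    rw [Finset.sum_comm]
    refine Finset.sum_congr rfl fun r _ => Finset.sum_congr rfl fun s _ => ?_
    rw [mul_comm]
  have h3 : ∑ r, x r * x r = ∑ r, ∑ s, if r = s then x r * x s else 0 := by simp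
  rw [two_mul]
  nth_rewrite 2 [h1]
  rw [h2, h1, h3, sq, Finset.sum_mul_sum, ← Finset.sum_add_distrib, ← Finset.sum_sub_distrib]
  refine Finset.sum_congr rfl fun r _ => ?_
  rw [← Finset.sum_add_distrib, ← Finset.sum_sub_distrib]
  refine Finset.sum_congr rfl fun s _ => ?_
  rcases lt_trichotomy r s with h | h | h
  · simp [h, h.not_gt, h.ne]
  · simp [h]
  · simp [h, h.not_gt, h.ne']

/-- With `k` matches the form counts `k` diagonal terms minus `k.choose 2` pairs. -/
theorem one_sub_qap4Form_vertex (i j : Fin m → Fin n) (σ : Perm (Fin n)) :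
    1 - qap4Form i j (vertex σ) = ((matchCount i j σ : ℝ) - 1) * ((matchCount i j σ : ℝ) - 2) / 2 := by
  set x : Fin m → ℝ := fun r => if σ (i r) = j r then 1 else 0 with hx
  have hk : ∑ r, x r = matchCount i j σ := by simp [hx, matchCount]
  have hk' : ∑ r, x r * x r = matchCount i j σ := by
    rw [← hk]
    exact Finset.sum_congr rfl fun r _ => by simp [hx]
  have h2 := two_mul_sum_Ioi_mul x
  rw [hk, hk'] at h2
  have : qap4Form i j (vertex σ) = ∑ r, x r * x r - ∑ r, ∑ s ∈ Finset.Ioi r, x r * x s := by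
    simp only [qap4Form_apply, vertex_apply, hx]
  rw [this, hk']
  linear_combination (1 / 2) * h2

theorem qap4Form_vertex_le (i j : Fin m → Fin n) (σ : Perm (Fin n)) :
    qap4Form i j (vertex σ) ≤ 1 := by
  have h := one_sub_qap4Form_vertex i j σ
  have : 0 ≤ ((matchCount i j σ : ℝ) - 1) * ((matchCount i j σ : ℝ) - 2) := by
    rcases (by omega : matchCount i j σ = 0 ∨ matchCount i j σ = 1 ∨ 2 ≤ matchCount i j σ) with hk | hk | hk
    · simp [hk]
    · simp [hk]
    · have : (2 : ℝ) ≤ matchCount i j σ := by exact_mod_cast hk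
      exact mul_nonneg (by linarith) (by linarith)
  linarith

theorem qap4Form_vertex_eq_one_iff (i j : Fin m → Fin n) (σ : Perm (Fin n)) :
    qap4Form i j (vertex σ) = 1 ↔ matchCount i j σ = 1 ∨ matchCount i j σ = 2 := by
  rw [← sub_eq_zero, ← neg_eq_zero, neg_sub, one_sub_qap4Form_vertex, div_eq_zero_iff,
    or_iff_left two_ne_zero, mul_eq_zero, sub_eq_zero, sub_eq_zero]
  norm_cast

theorem qap4Form_eq_zero_of_mem {i j : Fin m → Fin n} {X : Mat n} (hX : X ∈ vertexClass i j 0) :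
    qap4Form i j X = 0 := by
  obtain ⟨σ, hσ, rfl⟩ := mem_vertexClass.1 hX
  have := one_sub_qap4Form_vertex i j σ
  rw [hσ] at this
  norm_num at this
  exact this

theorem vertices_inter_eq_one (i j : Fin m → Fin n) :
    {Y ∈ vertices n | qap4Form i j Y = 1} = vertexClass i j 1 ∪ vertexClass i j 2 := by
  ext Y
  constructor
  · rintro ⟨⟨σ, rfl⟩, h⟩
    exact ((qap4Form_vertex_eq_one_iff i j σ).1 h).imp vertex_mem_vertexClass vertex_mem_vertexClass
  · rintro (⟨σ, h, rfl⟩ | ⟨σ, h, rfl⟩)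
    · exact ⟨⟨σ, rfl⟩, (qap4Form_vertex_eq_one_iff i j σ).2 (Or.inl h)⟩
    · exact ⟨⟨σ, rfl⟩, (qap4Form_vertex_eq_one_iff i j σ).2 (Or.inr h)⟩

theorem exists_perm_apply_eq {ι α : Type*} [Fintype α] [DecidableEq α] {i j : ι → α}
    (hi : Function.Injective i) (hj : Function.Injective j) : ∃ e : Perm α, ∀ r, e (i r) = j r := by
  classical
  let f : {x // x ∈ Set.range i} ≃ {x // x ∈ Set.range j} :=
    (Equiv.ofInjective i hi).symm.trans (Equiv.ofInjective j hj)
  refine ⟨f.extendSubtype, fun r => ?_⟩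
  rw [Equiv.extendSubtype_apply_of_mem f (i r) ⟨r, rfl⟩]
  have : (Equiv.ofInjective i hi).symm ⟨i r, ⟨r, rfl⟩⟩ = r := Equiv.ofInjective_symm_apply hi r
  simp [f, this]

/-- Reduces matches of `i` with `j` to fixed points in the image of `i`. -/
theorem matchCount_mul {i j : Fin m → Fin n} (hi : Function.Injective i) {e : Perm (Fin n)}
    (he : ∀ r, e (i r) = j r) (σ : Perm (Fin n)) :
    matchCount i j (e * σ) = (fixedIn (Finset.univ.image i) σ).card := by
  rw [matchCount, ← Finset.card_image_of_injective _ hi]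
  congr 1
  ext a
  simp only [Finset.mem_image, Finset.mem_filter, Finset.mem_univ, true_and, mem_fixedIn,
    Perm.mul_apply, ← he, e.injective.eq_iff]
  constructor
  · rintro ⟨r, hr, rfl⟩
    exact ⟨⟨r, rfl⟩, hr⟩
  · rintro ⟨⟨r, rfl⟩, hr⟩
    exact ⟨r, hr, rfl⟩

theorem exists_matchCount_eq {i j : Fin m → Fin n} (hi : Function.Injective i)
    (hj : Function.Injective j) {k : ℕ} (hk : k ≤ m) (hk2 : k + 2 ≤ n) :
    ∃ σ, matchCount i j σ = k := by
  obtain ⟨e, he⟩ := exists_perm_apply_eq hi hj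
  obtain ⟨σ, hσ⟩ := exists_card_fixedIn_eq (M := Finset.univ.image i) (k := k)
    (by rwa [Finset.card_image_of_injective _ hi, Finset.card_fin])
    (by rwa [Fintype.card_fin])
  exact ⟨e * σ, by rw [matchCount_mul hi he, hσ]⟩

theorem apply_vertex_eq_zero (hm : 7 ≤ m) {i j : Fin m → Fin n} (hi : Function.Injective i)
    (hj : Function.Injective j) (F : Mat n →ₗ[ℝ] ℝ) (h1 : ∀ Y ∈ vertexClass i j 1, F Y = 0)
    (h2 : ∀ Y ∈ vertexClass i j 2, F Y = 0) {X : Mat n} (hX : X ∈ vertexClass i j 0)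
    (hFX : F X = 0) (σ : Perm (Fin n)) : F (vertex σ) = 0 := by
  obtain ⟨e, he⟩ := exists_perm_apply_eq hi hj
  have hmn : m ≤ n := by simpa using Fintype.card_le_of_injective i hi
  have hM : (Finset.univ.image i).card = m := by
    rw [Finset.card_image_of_injective _ hi, Finset.card_fin]
  obtain ⟨ρ, hρ⟩ := exists_card_fixedIn_eq (M := Finset.univ.image i) (k := 3) (by omega)
    (by rw [Fintype.card_fin]; omega)
  -- The slack is `1` at three matches, so this `c` makes `G` vanish at `e * ρ`.
  set c := F (vertex (e * ρ)) with hc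
  set G : Mat n → ℝ := fun Y => F Y - c * (1 - qap4Form i j Y) with hG
  have hcube : CubeNull fun τ => G (vertex (e * τ)) :=
    (cubeNull_comp_vertex F e).sub
      (((cubeNull_const 1).sub (cubeNull_comp_vertex (qap4Form i j) e)).const_mul c)
  have hGρ : G (vertex (e * ρ)) = 0 := by
    simp only [hG, one_sub_qap4Form_vertex, matchCount_mul hi he, hρ, ← hc]
    norm_num
  have hGzero : ∀ τ, G (vertex τ) = 0 := by
    intro τ
    have := hcube.eq_zero (M := Finset.univ.image i) (by omega) (fun τ hτ => ?_) (fun τ hτ => ?_)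
      hρ hGρ (e⁻¹ * τ)
    · simpa using this
    · rw [← matchCount_mul hi he] at hτ
      simp only [hG]
      rw [h1 _ (vertex_mem_vertexClass hτ), (qap4Form_vertex_eq_one_iff i j _).2 (Or.inl hτ)]
      ring
    · rw [← matchCount_mul hi he] at hτ
      simp only [hG]
      rw [h2 _ (vertex_mem_vertexClass hτ), (qap4Form_vertex_eq_one_iff i j _).2 (Or.inr hτ)]
      ring
  have hGX : G X = 0 := by
    obtain ⟨τ, -, rfl⟩ := hX
    exact hGzero τ
  -- The slack is also `1` at `X`, where `F` vanishes.
  have hc0 : c = 0 := by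
    simp only [hG, hFX, qap4Form_eq_zero_of_mem hX] at hGX
    linarith
  have := hGzero σ
  simpa [hG, hc0] using this

theorem span_eq_span_vertices (hm : 7 ≤ m) {i j : Fin m → Fin n} (hi : Function.Injective i)
    (hj : Function.Injective j) {X : Mat n} (hX : X ∈ vertexClass i j 0) :
    Submodule.span ℝ (vertexClass i j 1 ∪ vertexClass i j 2 ∪ {X}) =
      Submodule.span ℝ (vertices n) := by
  apply le_antisymm
  · refine Submodule.span_mono (Set.union_subset (Set.union_subset (vertexClass_subset i j 1)
      (vertexClass_subset i j 2)) ?_)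
    rw [Set.singleton_subset_iff]
    exact vertexClass_subset i j 0 hX
  · rw [Submodule.span_le]
    rintro _ ⟨σ, rfl⟩
    by_contra hσ
    obtain ⟨F, hF, hker⟩ := Submodule.exists_le_ker_of_notMem hσ
    have hz : ∀ Y ∈ vertexClass i j 1 ∪ vertexClass i j 2 ∪ {X}, F Y = 0 := fun Y hY =>
      hker (Submodule.subset_span hY)
    exact hF (apply_vertex_eq_zero hm hi hj F (fun Y hY => hz Y (Or.inl (Or.inl hY)))
      (fun Y hY => hz Y (Or.inl (Or.inr hY))) hX (hz X (Or.inr rfl)) σ)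

end Vertices

/-! ### From linear span to facet dimension -/

section Facet

/-- A valid inequality `L ≤ b` for the convex hull of a set `V` in an affine hyperplane `T = 1`
is facet-defining, if the points of `V` on `L = b`, with one more point of `V`, span `V`. -/
theorem definesFacet_of_span {E : Type*} [AddCommGroup E] [Module ℝ E] [FiniteDimensional ℝ E]
    {V : Set E} {L T : E →ₗ[ℝ] ℝ} {b : ℝ} (hT : ∀ v ∈ V, T v = 1) (hL : ∀ v ∈ V, L v ≤ b)
    {X Y : E} (hX : X ∈ V) (hLX : L X ≠ b) (hY : Y ∈ V) (hLY : L Y = b)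
    (hspan : V ⊆ Submodule.span ℝ ({v ∈ V | L v = b} ∪ {X})) :
    DefinesFacet (convexHull ℝ V) L b := by
  have hval : ∀ x ∈ convexHull ℝ V, L x ≤ b :=
    fun x hx => convexHull_min hL (convex_halfSpace_le L.isLinear b) hx
  have hTP : ∀ x ∈ convexHull ℝ V, T x = 1 :=
    fun x hx => convexHull_min hT (convex_hyperplane T.isLinear 1) hx
  have hYF : Y ∈ {x ∈ convexHull ℝ V | L x = b} := ⟨subset_convexHull ℝ V hY, hLY⟩
  refine ⟨hval, ⟨Y, hYF⟩, ?_⟩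
  set P := convexHull ℝ V
  set U := vectorSpan ℝ {x ∈ P | L x = b} with hU
  have hUP : U ≤ vectorSpan ℝ P := vectorSpan_mono ℝ (Set.sep_subset _ _)
  have hUL : ∀ u ∈ U, L u = 0 := by
    intro u hu
    have : U ≤ LinearMap.ker L := by
      rw [hU, vectorSpan_def, Submodule.span_le]
      rintro _ ⟨x, hx, y, hy, rfl⟩
      simp [hx.2, hy.2]
    exact this hu
  have hXY : X - Y ∈ vectorSpan ℝ P :=
    vsub_mem_vectorSpan ℝ (subset_convexHull ℝ V hX) (subset_convexHull ℝ V hY)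
  have hTdir : ∀ u ∈ vectorSpan ℝ P, T u = 0 := by
    intro u hu
    have : vectorSpan ℝ P ≤ LinearMap.ker T := by
      rw [vectorSpan_def, Submodule.span_le]
      rintro _ ⟨x, hx, y, hy, rfl⟩
      simp [hTP x hx, hTP y hy]
    exact this hu
  have hPV : vectorSpan ℝ P ≤ Submodule.span ℝ V := by
    rw [vectorSpan_def, Submodule.span_le]
    have hPs : P ⊆ Submodule.span ℝ V :=
      convexHull_min Submodule.subset_span (Submodule.convex _)
    rintro _ ⟨x, hx, y, hy, rfl⟩
    exact Submodule.sub_mem _ (hPs hx) (hPs hy)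
  have hsup : vectorSpan ℝ P = U ⊔ Submodule.span ℝ {X - Y} := by
    apply le_antisymm
    · intro v hv
      have hdec : Submodule.span ℝ V ≤ Submodule.span ℝ {Y} ⊔ (U ⊔ Submodule.span ℝ {X - Y}) := by
        refine (Submodule.span_le.2 hspan).trans (Submodule.span_le.2 ?_)
        intro v hv
        rw [← add_sub_cancel Y v]
        refine Submodule.add_mem_sup (Submodule.mem_span_singleton_self Y) ?_
        rcases hv with hv | rfl
        · exact Submodule.mem_sup_left
            (vsub_mem_vectorSpan ℝ ⟨subset_convexHull ℝ V hv.1, hv.2⟩ hYF)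
        · exact Submodule.mem_sup_right (Submodule.mem_span_singleton_self _)
      obtain ⟨y, hy, u, hu, rfl⟩ := Submodule.mem_sup.1 (hdec (hPV hv))
      obtain ⟨t, rfl⟩ := Submodule.mem_span_singleton.1 hy
      have hu' : u ∈ vectorSpan ℝ P :=
        (sup_le hUP ((Submodule.span_singleton_le_iff_mem _ _).2 hXY)) hu
      -- `T` is `1` at `Y` and `0` on directions of `P`, so the coefficient of `Y` vanishes.
      have := hTdir _ hv
      rw [map_add, map_smul, hT Y hY, hTdir u hu'] at this
      have ht : t = 0 := by simpa using this
      simpa [ht] using hu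
    · exact sup_le hUP ((Submodule.span_singleton_le_iff_mem _ _).2 hXY)
  have hnot : X - Y ∉ U := fun h => hLX (by
    have := hUL _ h
    rw [map_sub, hLY, sub_eq_zero] at this
    exact this)
  apply le_antisymm
  · exact Submodule.finrank_lt_finrank_of_lt (lt_of_le_of_ne hUP fun h => hnot (h ▸ hXY))
  · rw [hsup]
    refine (Submodule.finrank_add_le_finrank_add_finrank _ _).trans ?_
    rw [finrank_span_singleton fun h : X - Y = 0 => hnot (h ▸ U.zero_mem)]

end Facet

end QAP

theorem mainTheorem1 (n m : ℕ) (hn : 7 ≤ n) (hm : 7 ≤ m) (i j : Fin m → Fin n)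
    (hi : Function.Injective i) (hj : Function.Injective j) :
    DefinesFacet (QAP.polytope n) (QAP.qap4Form i j) 1 ∧
      {Y ∈ QAP.vertices n | QAP.qap4Form i j Y = 1} =
        QAP.vertexClass i j 1 ∪ QAP.vertexClass i j 2 ∧
      (QAP.vertexClass i j 0).Nonempty ∧
      ∀ X ∈ QAP.vertexClass i j 0,
        Submodule.span ℝ (QAP.vertexClass i j 1 ∪ QAP.vertexClass i j 2 ∪ {X}) =
          Submodule.span ℝ (QAP.vertices n) := by
  obtain ⟨σ, hσ⟩ := QAP.exists_matchCount_eq hi hj (k := 0) (by omega) (by omega)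
  obtain ⟨τ, hτ⟩ := QAP.exists_matchCount_eq hi hj (k := 1) (by omega) (by omega)
  have hX := QAP.vertex_mem_vertexClass hσ
  refine ⟨?_, QAP.vertices_inter_eq_one i j, ⟨_, hX⟩,
    fun X hX => QAP.span_eq_span_vertices hm hi hj hX⟩
  let a : Fin n := ⟨0, by omega⟩
  -- On a vertex, this sums row `a` of the permutation matrix, as its entries are their own squares;
  -- hence `T = 1` there.
  let T : QAP.Mat n →ₗ[ℝ] ℝ := ∑ b : Fin n, Matrix.entryLinearMap ℝ ℝ (a, b) (a, b)
  refine QAP.definesFacet_of_span (T := T) ?_ ?_ ⟨σ, rfl⟩ ?_ ⟨τ, rfl⟩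
    ((QAP.qap4Form_vertex_eq_one_iff i j τ).2 (Or.inl hτ)) ?_
  · rintro _ ⟨ρ, rfl⟩
    simp [T, QAP.vertex_apply]
  · rintro _ ⟨ρ, rfl⟩
    exact QAP.qap4Form_vertex_le i j ρ
  · simp [QAP.qap4Form_eq_zero_of_mem hX]
  · rw [QAP.vertices_inter_eq_one, QAP.span_eq_span_vertices hm hi hj hX]
    exact Submodule.subset_span
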